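/- Let $C\subset[0,1]$ be the triadic Cantor set and $K=C-\tfrac12\subset\mathbb{R}\subset\mathbb{C}$ the centred Cantor set (so $0\notin K$). Identify the ring of $2$-adic integers $\mathbb{Z}_2$ with $C$ by $\sum_{n\ge 0}a_n2^n\mapsto\sum_{n\ge 0}2a_n3^{-(n+1)}$ ($a_n\in\{0,1\}$), and let $\mu$ be the probability measure on $K$ obtained by transporting the normalized Haar measure of $\mathbb{Z}_2$ to $C$ and translating it by $-\tfrac12$. Let $$f_\mu(z)=\frac{1}{2\pi i}\int_{\mathbb{C}}\frac{d\mu(t)}{z-t}\qquad(z\in\mathbb{C}\setminus K)$$ be its Cauchy transform, and let $F_\mu(z)=\int_0^z f_\mu(t)\,dt$ be its primitive, a holomorphic germ at $0$. Then the germ of $F_\mu$ at $0$ has an analytic continuation along every loop $\gamma$ in $\mathbb{C}\setminus K$ based at $0$. The value $\mathrm{Mon}_\gamma(F_\mu)$ at $0$ of the branch obtained at the end of $\gamma$ does not depend on the continuation chosen, and it depends only on the homotopy class $[\gamma]\in\pi_1(\mathbb{C}\setminus K,0)$. The resulting map $\mathrm{Mon}:\pi_1(\mathbb{C}\setminus K,0)\to(\mathbb{C},+)$,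 $[\gamma]\mapsto\mathrm{Mon}_\gamma(F_\mu)$, is a group homomorphism, and its image, the Weierstrass monodromy group of $F_\mu$ at $0$, is exactly the group of dyadic rationals $$\mathrm{Mon}_{z=0}\,F_\mu=\sum_{k\ge 0}2^{-k}\mathbb{Z}=\mathbb{Z}[\tfrac12]\subset\mathbb{C}.$$ -/

import Mathlib

open scoped Topology

noncomputable section

namespace CantorMonodromy

/-! ### The triadic Cantor set and its equilibrium measure -/

/-- The ring of `2`-adic integers carries its Borel sigma-algebra. -/
instance instMeasurableSpacePadicInt : MeasurableSpace ℤ_[2] := borel ℤ_[2]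

instance instBorelSpacePadicInt : BorelSpace ℤ_[2] := ⟨rfl⟩

/-- The `n`-th binary digit `aₙ` of a `2`-adic integer `x = ∑ aₙ 2 ^ n`, read off from the residue
of `x` modulo `2 ^ (n + 1)`. -/
def binaryDigit (x : ℤ_[2]) (n : ℕ) : Bool :=
  (PadicInt.toZModPow (n + 1) x).val.testBit n

/-- The standard identification of `ℤ_[2]` with the triadic Cantor set `C ⊆ [0, 1]`: the `2`-adic
integer `∑ aₙ 2 ^ n` goes to the real number `∑ 2 aₙ 3 ^ (-(n + 1))`. -/
def toCantor (x : ℤ_[2]) : ℝ :=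
  Real.ofDigits (b := 3) fun n => cond (binaryDigit x n) 2 0

/-- The identification is continuous, so the push-forward below is along a measurable map. -/
theorem continuous_toCantor : Continuous toCantor := by
  refine Real.continuous_ofDigits.comp (continuous_pi fun n => ?_)
  refine (IsLocallyConstant.iff_eventually_eq _ |>.2 ?_).continuous
  intro x
  have hball : ∀ᶠ y in 𝓝 x, ‖y - x‖ ≤ (2 : ℝ) ^ (-((n + 1 : ℕ) : ℤ)) := by
    have := Metric.closedBall_mem_nhds x (show 0 < (2 : ℝ) ^ (-((n + 1 : ℕ) : ℤ)) by positivity)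
    filter_upwards [this] with y hy
    simpa [dist_eq_norm] using hy
  filter_upwards [hball] with y hy
  have h : PadicInt.toZModPow (n + 1) y = PadicInt.toZModPow (n + 1) x := by
    rw [← sub_eq_zero, ← map_sub, ← RingHom.mem_ker, PadicInt.ker_toZModPow]
    exact (PadicInt.norm_le_pow_iff_mem_span_pow _ _).1 (by exact_mod_cast hy)
  simp [binaryDigit, h]

/-- The translation `x ↦ x - 1/2`, followed by the inclusion `ℝ ⊆ ℂ`. -/
def centre (x : ℝ) : ℂ := ((x - 1 / 2 : ℝ) : ℂ)

/-- The centred triadic Cantor set `K = C - 1/2`, as a subset of `ℂ`. -/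
def centredCantorSet : Set ℂ := centre '' cantorSet

/-- The Haar probability measure of the compact additive group `ℤ_[2]`. -/
def haarPadic : MeasureTheory.Measure ℤ_[2] :=
  MeasureTheory.Measure.addHaarMeasure ⊤

/-- The equilibrium measure of the centred Cantor set `K`: the Haar probability measure of `ℤ_[2]`
carried over to the Cantor set and translated by `-1/2`. -/
def cantorMeasure : MeasureTheory.Measure ℂ :=
  haarPadic.map fun x => centre (toCantor x)

/-! ### The Cauchy transform and its primitive -/

/-- The Cauchy transform `f_μ(z) = (2πi)⁻¹ ∫ dμ(t) / (z - t)` of a measure `μ` on `ℂ`. -/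
def cauchyTransform (μ : MeasureTheory.Measure ℂ) (z : ℂ) : ℂ :=
  (2 * (Real.pi : ℂ) * Complex.I)⁻¹ * ∫ t, (z - t)⁻¹ ∂μ

/-- The primitive `∫₀ᶻ f(t) dt` of `f`, the integral being taken along the segment from `0` to `z`.
Only its germ at `0` is used below. -/
def primitiveAtZero (f : ℂ → ℂ) (z : ℂ) : ℂ :=
  ∫ s in (0 : ℝ)..1, f ((s : ℂ) * z) * z

/-! ### Analytic continuation along a path -/

/-- `G` is an analytic continuation along the path `γ` of the germ of `F` at the starting point of
`γ`: each `G t` is analytic at `γ t`, the germ of `G 0` is the germ of `F`, and for `s` close to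
`t` the germ of `G s` at `γ s` is the one defined by `G t`. -/
structure IsAnalyticContinuationAlong {a b : ℂ} (γ : Path a b) (F : ℂ → ℂ)
    (G : unitInterval → ℂ → ℂ) : Prop where
  analyticAt : ∀ t, AnalyticAt ℂ (G t) (γ t)
  start : G 0 =ᶠ[𝓝 a] F
  compatible : ∀ t, ∀ᶠ s in 𝓝 t, G s =ᶠ[𝓝 (γ s)] G t

/-- `w` is the value, at the end point of the path `γ`, of the branch of `F` obtained by analytic
continuation along `γ`. -/
def IsBranchValue {a b : ℂ} (γ : Path a b) (F : ℂ → ℂ) (w : ℂ) : Prop :=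
  ∃ G : unitInterval → ℂ → ℂ, IsAnalyticContinuationAlong γ F G ∧ G 1 b = w

/-! ### The base point and the dyadic rationals -/

theorem zero_notMem_centredCantorSet : (0 : ℂ) ∉ centredCantorSet := by
  rintro ⟨x, hx, h⟩
  have h2 : x = 1 / 2 := by
    have h3 : x - 1 / 2 = 0 := Complex.ofReal_eq_zero.mp h
    linarith
  subst h2
  rw [cantorSet_eq_union_halves] at hx
  rcases hx with ⟨y, hy, h⟩ | ⟨y, hy, h⟩ <;>
  · have := cantorSet_subset_unitInterval hy
    simp only [Set.mem_Icc] at this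
    simp only at h
    linarith [this.1, this.2]

/-- The origin, as a point of `ℂ ∖ K`. -/
def origin : (centredCantorSetᶜ : Set ℂ) := ⟨0, zero_notMem_centredCantorSet⟩

/-- The group of dyadic rationals `∑ₖ 2⁻ᵏ ℤ`, as an additive subgroup of `ℂ`. -/
def dyadicRationals : AddSubgroup ℂ :=
  ⨆ k : ℕ, AddSubgroup.zmultiples (((2 : ℂ) ^ k)⁻¹)

end CantorMonodromy

end

open scoped Topology

noncomputable section

namespace CantorMonodromy

open MeasureTheory Complex Filter

/-! Near `0`, `F_μ` is the Haar average over `x : ℤ_[2]` of `(2πi)⁻¹ log ((z - κ x) / (0 - κ x))`,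
where `κ` parametrizes `K`. Continuing `F_μ` along a path amounts to continuing all these logarithms
at once. After a loop, the value at `0` is therefore the average of the winding numbers of the loop
about the points `κ x`. Homotopy invariance and additivity are those of lifts through `exp`
(`logLift_one_eq_of_homotopic`, `logLift_trans`); continuation and its uniqueness are
`isAnalyticContinuationAlong_pathPrimitive` and `IsAnalyticContinuationAlong.eventuallyEq`.

The winding number is a continuous integer-valued function on `ℤ_[2]`, so it factors through some
`ZMod (2 ^ k)`, and its Haar integral is an integer divided by `2 ^ k`. Conversely, the difference
of two circles, one around the whole left half of `K` and one missing only its leftmost piece of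
level `k + 2`, winds once around that piece, which has measure `2 ^ (-(k + 2))`
(`exists_pathPrimitive_sub_eq`). These values generate the dyadic rationals. -/

/-! ### Logarithms along paths -/

section LogLift

variable {A : Type*} [TopologicalSpace A] {κ : C(A, ℂ)} {U : Set ℂ}

/-- The map `(z, x) ↦ (z - κ x) / (a - κ x)` into the punctured plane, for `κ` avoiding `U`. -/
def ratioMap (hκ : ∀ x, κ x ∉ U) (a : U) : C(U × A, {z : ℂ // z ≠ 0}) where
  toFun p := ⟨(p.1 - κ p.2) / (a - κ p.2),
    div_ne_zero (sub_ne_zero.2 fun h => hκ _ (h ▸ p.1.2)) (sub_ne_zero.2 fun h => hκ _ (h ▸ a.2))⟩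
  continuous_toFun := by
    refine Continuous.subtype_mk (Continuous.div (by fun_prop) (by fun_prop) fun p => ?_) _
    exact sub_ne_zero.2 fun h => hκ _ (h ▸ a.2)

/-- The continuous logarithm of `(γ s - κ x) / (γ 0 - κ x)` that vanishes at `s = 0`. -/
def logLift (hκ : ∀ x, κ x ∉ U) {a b : U} (γ : Path a b) : C(unitInterval × A, ℂ) :=
  isCoveringMap_exp.liftHomotopy ((ratioMap hκ a).comp (γ.toContinuousMap.prodMap (.id A)))
    (.const A 0) fun x => Subtype.ext <| by
      have : (a : ℂ) - κ x ≠ 0 := sub_ne_zero.2 fun h => hκ x (h ▸ a.2)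
      simp [ratioMap, div_self this]

variable (hκ : ∀ x, κ x ∉ U) {a b c : U}

theorem logLift_zero (γ : Path a b) (x : A) : logLift hκ γ (0, x) = 0 :=
  isCoveringMap_exp.liftHomotopy_zero _ _ _ x

theorem exp_logLift (γ : Path a b) (s : unitInterval) (x : A) :
    exp (logLift hκ γ (s, x)) = (γ s - κ x) / (a - κ x) :=
  congrArg Subtype.val (congrFun (isCoveringMap_exp.liftHomotopy_lifts
    ((ratioMap hκ a).comp (γ.toContinuousMap.prodMap (.id A))) (.const A 0) _) (s, x))

theorem eq_of_exp_eq {Γ Γ' : unitInterval → ℂ} (hΓ : Continuous Γ) (hΓ' : Continuous Γ') (h0 : Γ 0 = Γ' 0)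
    (h : ∀ s, exp (Γ s) = exp (Γ' s)) : Γ = Γ' :=
  isCoveringMap_exp.eq_of_comp_eq hΓ hΓ' (funext fun s => Subtype.ext (h s)) 0 h0

/-- Lifts through `exp` are unique, so winding numbers can be computed by exhibiting any continuous
logarithm. -/
theorem logLift_eq (γ : Path a b) (x : A) {Γ : unitInterval → ℂ} (hΓ : Continuous Γ) (h0 : Γ 0 = 0)
    (h : ∀ s, exp (Γ s) = (γ s - κ x) / (a - κ x)) (s : unitInterval) : logLift hκ γ (s, x) = Γ s :=
  congrFun (eq_of_exp_eq (Γ := fun s => logLift hκ γ (s, x)) (by fun_prop) hΓ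
    ((logLift_zero hκ γ x).trans h0.symm) fun s => (exp_logLift hκ γ s x).trans (h s).symm) s

theorem logLift_one_eq_of_homotopic {γ γ' : Path a b} (h : γ.Homotopic γ') (x : A) :
    logLift hκ γ (1, x) = logLift hκ γ' (1, x) := by
  have h' := ContinuousMap.HomotopicRel.comp_continuousMap h
    ((ratioMap hκ a).comp ((ContinuousMap.id U).prodMk (.const U x)))
  exact isCoveringMap_exp.liftPath_apply_one_eq_of_homotopicRel h' _ _ _

theorem logLift_trans (γ : Path a b) (γ' : Path b c) (x : A) :
    logLift hκ (γ.trans γ') (1, x) = logLift hκ γ (1, x) + logLift hκ γ' (1, x) := by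
  have hb : (b : ℂ) - κ x ≠ 0 := sub_ne_zero.2 fun h => hκ x (h ▸ b.2)
  let Γ : Path (0 : ℂ) (logLift hκ γ (1, x)) :=
    ⟨⟨fun s => logLift hκ γ (s, x), by fun_prop⟩, logLift_zero hκ γ x, rfl⟩
  let Γ' : Path (logLift hκ γ (1, x)) (logLift hκ γ (1, x) + logLift hκ γ' (1, x)) :=
    ⟨⟨fun s => logLift hκ γ (1, x) + logLift hκ γ' (s, x), by fun_prop⟩,
      by simp [logLift_zero], rfl⟩
  rw [logLift_eq hκ (γ.trans γ') x (Γ.trans Γ').continuous (Γ.trans Γ').source, Path.target]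
  intro s
  rw [Path.trans_apply, Path.trans_apply]
  split_ifs with hs
  · exact exp_logLift hκ γ _ x
  · change exp (logLift hκ γ (1, x) + logLift hκ γ' (_, x)) = _
    rw [exp_add, exp_logLift, exp_logLift, γ.target]
    field_simp

theorem exists_logLift_one_eq (γ : Path a a) (x : A) :
    ∃ n : ℤ, logLift hκ γ (1, x) = n * (2 * Real.pi * Complex.I) := by
  have ha : (a : ℂ) - κ x ≠ 0 := sub_ne_zero.2 fun h => hκ x (h ▸ a.2)
  rw [← exp_eq_one_iff, exp_logLift, γ.target, div_self ha]

end LogLift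

/-! ### Averages of logarithms -/

section Averages

section

variable {A : Type*} [MeasurableSpace A] {ν : Measure A}

variable (ν) in
/-- The average of the branches at `c` of the logarithms of `(z - κ x) / (c - κ x)`. -/
def averageLog (κ : A → ℂ) (c z : ℂ) : ℂ :=
  (2 * (Real.pi : ℂ) * Complex.I)⁻¹ * ∫ x, log ((z - κ x) / (c - κ x)) ∂ν

theorem averageLog_self {κ : A → ℂ} {c : ℂ} (hc : ∀ x, c ≠ κ x) : averageLog ν κ c c = 0 := by
  have (x : A) : (c - κ x) / (c - κ x) = 1 := div_self (sub_ne_zero.2 (hc x))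
  simp [averageLog, this]

end

variable {A : Type*} [TopologicalSpace A] {κ : C(A, ℂ)} {U : Set ℂ}

theorem norm_div_sub_one_lt {c z k : ℂ} {δ : ℝ} (h : δ ≤ ‖c - k‖) (hz : ‖z - c‖ < δ) :
    ‖(z - k) / (c - k) - 1‖ < 1 := by
  have h0 : 0 < ‖c - k‖ := (norm_nonneg _).trans_lt (hz.trans_le h)
  rw [div_sub_one (norm_pos_iff.1 h0), norm_div, div_lt_one h0, sub_sub_sub_cancel_right]
  exact hz.trans_le h

theorem re_pos_of_norm_sub_one_lt {u : ℂ} (h : ‖u - 1‖ < 1) : 0 < u.re := by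
  have := (abs_le.1 (abs_re_le_norm (u - 1))).1
  simp only [sub_re, one_re] at this
  linarith

theorem continuous_log_ratio {c z : ℂ} {δ : ℝ} (h : ∀ x, δ ≤ ‖c - κ x‖) (hz : ‖z - c‖ < δ) :
    Continuous fun x => log ((z - κ x) / (c - κ x)) := by
  have h0 (x : A) : c - κ x ≠ 0 :=
    norm_pos_iff.1 ((norm_nonneg _).trans_lt (hz.trans_le (h x)))
  refine Continuous.clog (Continuous.div (by fun_prop) (by fun_prop) h0) fun x => ?_
  exact Or.inl (re_pos_of_norm_sub_one_lt (norm_div_sub_one_lt (h x) hz))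

variable [CompactSpace A]

theorem exists_pos_le_norm_sub (κ : C(A, ℂ)) {c : ℂ} (hc : ∀ x, c ≠ κ x) :
    ∃ δ > 0, ∀ x, δ ≤ ‖c - κ x‖ := by
  have hc' : c ∈ (Set.range κ)ᶜ := fun ⟨x, hx⟩ => hc x hx.symm
  obtain ⟨δ, hδ, h⟩ := Metric.isOpen_iff.1 (isCompact_range κ.continuous).isClosed.isOpen_compl c hc'
  refine ⟨δ, hδ, fun x => not_lt.1 fun hx => h (a := κ x) ?_ ⟨x, rfl⟩⟩
  rwa [Metric.mem_ball, dist_comm, dist_eq_norm]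

variable [MeasurableSpace A] {ν : Measure A} [BorelSpace A] [IsFiniteMeasure ν]

theorem integrable_of_continuous {g : A → ℂ} (hg : Continuous g) : Integrable g ν :=
  hg.integrable_of_hasCompactSupport (HasCompactSupport.of_compactSpace g)

theorem hasDerivAt_averageLog {c z : ℂ} {δ : ℝ} (h : ∀ x, δ ≤ ‖c - κ x‖) (hz : ‖z - c‖ < δ) :
    HasDerivAt (averageLog ν κ c) ((2 * (Real.pi : ℂ) * Complex.I)⁻¹ * ∫ x, (z - κ x)⁻¹ ∂ν) z := by
  refine HasDerivAt.const_mul _ ?_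
  -- Half of the room left in the disc: every `w` within `r` of `z` then stays at distance at least
  -- `r` from all `κ x`, which gives the dominating constant `r⁻¹`.
  set r := (δ - ‖z - c‖) / 2 with hr
  have hr0 : 0 < r := by linarith
  have hball : ∀ w ∈ Metric.ball z r, ‖w - c‖ < δ - r := fun w hw => by
    rw [Metric.mem_ball, dist_eq_norm] at hw
    have := norm_sub_le_norm_sub_add_norm_sub w z c
    linarith
  have hlow : ∀ w ∈ Metric.ball z r, ∀ x, r ≤ ‖w - κ x‖ := fun w hw x => by
    have := norm_sub_le_norm_sub_add_norm_sub c w (κ x)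
    rw [norm_sub_rev c w] at this
    linarith [hball w hw, h x]
  refine (hasDerivAt_integral_of_dominated_loc_of_deriv_le (Metric.ball_mem_nhds z hr0)
    (F' := fun w x => (w - κ x)⁻¹) (bound := fun _ => r⁻¹) ?_ ?_ ?_ ?_ ?_ ?_).2
  · filter_upwards [Metric.ball_mem_nhds z hr0] with w hw
    exact (integrable_of_continuous (continuous_log_ratio h
      ((hball w hw).trans (by linarith)))).aestronglyMeasurable
  · exact integrable_of_continuous (continuous_log_ratio h hz)
  · refine (integrable_of_continuous (Continuous.inv₀ (by fun_prop) fun x => ?_)).aestronglyMeasurable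
    exact norm_pos_iff.1 (hr0.trans_le (hlow z (Metric.mem_ball_self hr0) x))
  · refine .of_forall fun x w hw => ?_
    rw [norm_inv]
    exact inv_anti₀ hr0 (hlow w hw x)
  · exact integrable_const _
  · refine .of_forall fun x w hw => ?_
    have h1 : ‖w - c‖ < δ := (hball w hw).trans (by linarith)
    have hc0 : c - κ x ≠ 0 := norm_pos_iff.1 ((norm_nonneg _).trans_lt (h1.trans_le (h x)))
    have hw0 : w - κ x ≠ 0 := norm_pos_iff.1 (hr0.trans_le (hlow w hw x))
    have hs := Or.inl (b := ((w - κ x) / (c - κ x)).im ≠ 0)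
      (re_pos_of_norm_sub_one_lt (norm_div_sub_one_lt (h x) h1))
    convert! (((hasDerivAt_id w).sub_const (κ x)).div_const (c - κ x)).clog hs using 1
    simp only [id]
    field_simp

theorem analyticAt_averageLog {c : ℂ} (hc : ∀ x, c ≠ κ x) : AnalyticAt ℂ (averageLog ν κ c) c := by
  obtain ⟨δ, hδ, h⟩ := exists_pos_le_norm_sub κ hc
  have hd : DifferentiableOn ℂ (averageLog ν κ c) (Metric.ball c δ) := fun z hz =>
    (hasDerivAt_averageLog h (by
      rwa [Metric.mem_ball, dist_eq_norm] at hz)).differentiableAt.differentiableWithinAt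
  exact hd.analyticAt (Metric.ball_mem_nhds c hδ)

/-- The segment primitive of the Cauchy transform is an average of logarithms. -/
theorem primitiveAtZero_eventuallyEq (h0 : ∀ x, (0 : ℂ) ≠ κ x) :
    averageLog ν κ 0 =ᶠ[𝓝 0] primitiveAtZero
      fun z => (2 * (Real.pi : ℂ) * Complex.I)⁻¹ * ∫ x, (z - κ x)⁻¹ ∂ν := by
  obtain ⟨δ, hδ, h⟩ := exists_pos_le_norm_sub κ h0
  have hD : ∀ z ∈ Metric.ball (0 : ℂ) δ, HasDerivAt (averageLog ν κ 0)
      ((2 * (Real.pi : ℂ) * Complex.I)⁻¹ * ∫ x, (z - κ x)⁻¹ ∂ν) z := fun z hz =>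
    hasDerivAt_averageLog h (by rwa [Metric.mem_ball, dist_eq_norm] at hz)
  have hcont : ContinuousOn
      (fun z => (2 * (Real.pi : ℂ) * Complex.I)⁻¹ * ∫ x, (z - κ x)⁻¹ ∂ν) (Metric.ball 0 δ) := by
    have hd : DifferentiableOn ℂ (averageLog ν κ 0) (Metric.ball 0 δ) := fun z hz =>
      (hD z hz).differentiableAt.differentiableWithinAt
    exact (hd.deriv Metric.isOpen_ball).continuousOn.congr fun z hz => (hD z hz).deriv.symm
  filter_upwards [Metric.ball_mem_nhds 0 hδ] with z hz
  have hmem : ∀ s ∈ Set.uIcc (0 : ℝ) 1, (s : ℂ) * z ∈ Metric.ball (0 : ℂ) δ := fun s hs => by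
    rw [Set.uIcc_of_le zero_le_one] at hs
    rw [mem_ball_zero_iff] at hz ⊢
    rw [norm_mul, norm_real, Real.norm_of_nonneg hs.1]
    exact (mul_le_of_le_one_left (norm_nonneg z) hs.2).trans_lt hz
  have key := intervalIntegral.integral_eq_sub_of_hasDerivAt (a := 0) (b := 1)
    (f := fun s : ℝ => averageLog ν κ 0 ((s : ℂ) * z))
    (f' := fun s : ℝ =>
      (2 * (Real.pi : ℂ) * Complex.I)⁻¹ * (∫ x, ((s : ℂ) * z - κ x)⁻¹ ∂ν) * z)
    (fun s hs => HasDerivAt.comp s (h₂ := averageLog ν κ 0) (hD _ (hmem s hs)) (by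
      simpa using (hasDerivAt_id s).ofReal_comp.mul_const z))
    (ContinuousOn.intervalIntegrable
      ((hcont.comp (by fun_prop) hmem).mul continuousOn_const))
  rw [primitiveAtZero, key]
  simp [averageLog_self h0]

end Averages

/-! ### Existence and uniqueness of the continuation -/

/-- Both ratios on the left lie in the right half-plane, so their arguments add up without leaving
`(-π, π)`. -/
theorem log_div_add_log_div {c₀ c z k : ℂ} {δ : ℝ} (h : δ ≤ ‖c₀ - k‖) (hc : ‖c - c₀‖ < δ / 2)
    (hz : ‖z - c‖ < δ / 2) :
    log ((c - k) / (c₀ - k)) + log ((z - k) / (c - k)) = log ((z - k) / (c₀ - k)) := by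
  have hck : δ / 2 ≤ ‖c - k‖ := by
    have := norm_sub_le_norm_sub_add_norm_sub c₀ c k
    rw [norm_sub_rev c₀ c] at this
    linarith
  have hδ : 0 < δ / 2 := (norm_nonneg _).trans_lt hc
  have h1 := re_pos_of_norm_sub_one_lt (norm_div_sub_one_lt h (hc.trans (by linarith)))
  have h2 := re_pos_of_norm_sub_one_lt (norm_div_sub_one_lt hck hz)
  have hc0 : c - k ≠ 0 := norm_pos_iff.1 (hδ.trans_le hck)
  have ne {u : ℂ} (hu : 0 < u.re) : u ≠ 0 := fun h => by simp [h] at hu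
  have a1 := abs_lt.1 (abs_arg_lt_pi_div_two_iff.2 (Or.inl h1))
  have a2 := abs_lt.1 (abs_arg_lt_pi_div_two_iff.2 (Or.inl h2))
  rw [← log_mul (ne h1) (ne h2) ⟨by linarith [a1.1, a2.1], by linarith [a1.2, a2.2]⟩]
  congr 1
  field_simp

section Continuation

variable {A : Type*} [TopologicalSpace A] [CompactSpace A] {κ : C(A, ℂ)} {U : Set ℂ}
  (hκ : ∀ x, κ x ∉ U) {a b : U}

theorem logLift_sub_logLift (γ : Path a b) (t : unitInterval) :
    ∀ᶠ s in 𝓝 t, ∀ x, logLift hκ γ (s, x) =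
      logLift hκ γ (t, x) + log ((γ s - κ x) / (γ t - κ x)) := by
  have hne (s : unitInterval) (x : A) : (γ s : ℂ) ≠ κ x := fun h => hκ x (h ▸ (γ s).2)
  obtain ⟨δ, hδ, hlow⟩ := exists_pos_le_norm_sub κ (hne t)
  have hγ : Tendsto (fun s => (γ s : ℂ)) (𝓝 t) (𝓝 (γ t)) :=
    (continuous_subtype_val.comp γ.continuous).tendsto t
  have hnear : ∀ᶠ s in 𝓝 t, ‖(γ s : ℂ) - γ t‖ < δ := by
    filter_upwards [hγ (Metric.ball_mem_nhds _ hδ)] with s hs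
    rwa [← dist_eq_norm]
  -- `D` takes values in `2πiℤ` near `t` and vanishes at `s = t`. Compactness of `A` gives `‖D‖ <
  -- 2π` for all `x` simultaneously, so `D = 0` on one neighbourhood of `t` independent of `x`.
  let D : unitInterval × A → ℂ := fun p =>
    logLift hκ γ p - logLift hκ γ (t, p.2) - log ((γ p.1 - κ p.2) / (γ t - κ p.2))
  have hsmall : ∀ᶠ s in 𝓝 t, ∀ x ∈ Set.univ, ‖D (s, x)‖ < 2 * Real.pi := by
    refine isCompact_univ.eventually_forall_of_forall_eventually fun x _ => ?_
    have hD : ContinuousAt D (t, x) := by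
      have hn : Continuous fun p : unitInterval × A => (γ p.1 : ℂ) - κ p.2 := by fun_prop
      have hd : Continuous fun p : unitInterval × A => (γ t : ℂ) - κ p.2 := by fun_prop
      have hr := (hn.continuousAt (x := (t, x))).div hd.continuousAt (sub_ne_zero.2 (hne t x))
      have hl : Continuous fun p : unitInterval × A =>
        logLift hκ γ p - logLift hκ γ (t, p.2) := by fun_prop
      refine hl.continuousAt.sub (hr.clog ?_)
      simp [div_self (sub_ne_zero.2 (hne t x))]
    have h0 : D (t, x) = 0 := by simp [D, div_self (sub_ne_zero.2 (hne t x))]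
    have := hD.norm.eventually_lt_const (u := 2 * Real.pi) (by simp [h0, Real.pi_pos])
    exact this
  filter_upwards [hsmall] with s hs x
  have hexp : exp (D (s, x)) = 1 := by
    have h1 := sub_ne_zero.2 (hne s x)
    have h2 := sub_ne_zero.2 (hne t x)
    have h3 : (a : ℂ) - κ x ≠ 0 := by simpa using sub_ne_zero.2 (hne 0 x)
    simp only [D]
    rw [exp_sub, exp_sub, exp_logLift, exp_logLift, exp_log (div_ne_zero h1 h2)]
    field_simp
  obtain ⟨n, hn⟩ := exp_eq_one_iff.1 hexp
  have hlt := hs x trivial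
  have hn0 : n = 0 := by
    rw [hn, norm_mul, norm_mul, norm_mul, norm_I, norm_intCast, mul_one] at hlt
    simp only [Complex.norm_ofNat, norm_real, Real.norm_of_nonneg Real.pi_pos.le] at hlt
    have : |(n : ℝ)| < 1 := by
      by_contra! hge
      nlinarith [Real.pi_pos]
    exact Int.abs_lt_one_iff.1 (by exact_mod_cast this)
  have hD0 : D (s, x) = 0 := by simpa [hn0] using hn
  simp only [D] at hD0
  linear_combination hD0

variable [MeasurableSpace A] [BorelSpace A] (ν : Measure A)

/-- The primitive along the path `γ` of the Cauchy transform of the image of `ν` under `κ`. -/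
def pathPrimitive (γ : Path a b) (s : unitInterval) : ℂ :=
  (2 * (Real.pi : ℂ) * Complex.I)⁻¹ * ∫ x, logLift hκ γ (s, x) ∂ν

variable [IsFiniteMeasure ν]

theorem averageLog_add_averageLog {c₀ c z : ℂ} {δ : ℝ} (h : ∀ x, δ ≤ ‖c₀ - κ x‖)
    (hc : ‖c - c₀‖ < δ / 2) (hz : ‖z - c‖ < δ / 2) :
    averageLog ν κ c₀ c + averageLog ν κ c z = averageLog ν κ c₀ z := by
  have hδ : 0 < δ / 2 := (norm_nonneg _).trans_lt hc
  have hc' (x : A) : δ / 2 ≤ ‖c - κ x‖ := by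
    have := norm_sub_le_norm_sub_add_norm_sub c₀ c (κ x)
    rw [norm_sub_rev c₀ c] at this
    linarith [h x]
  rw [averageLog, averageLog, averageLog, ← mul_add, ← integral_add]
  · simp_rw [log_div_add_log_div (h _) hc hz]
  · exact integrable_of_continuous (continuous_log_ratio h (hc.trans (by linarith)))
  · exact integrable_of_continuous (continuous_log_ratio hc' hz)

theorem pathPrimitive_eventually_eq (γ : Path a b) (t : unitInterval) :
    ∀ᶠ s in 𝓝 t, pathPrimitive hκ ν γ s =
      pathPrimitive hκ ν γ t + averageLog ν κ (γ t) (γ s) := by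
  filter_upwards [logLift_sub_logLift hκ γ t] with s hs
  have hint (s : unitInterval) : Integrable (fun x => logLift hκ γ (s, x)) ν :=
    integrable_of_continuous (by fun_prop)
  have : ∀ x, log ((γ s - κ x) / (γ t - κ x)) = logLift hκ γ (s, x) - logLift hκ γ (t, x) :=
    fun x => by rw [hs x]; ring
  simp_rw [pathPrimitive, averageLog, this]
  rw [integral_sub (hint s) (hint t)]
  ring

theorem pathPrimitive_trans {c : U} (γ : Path a b) (γ' : Path b c) :
    pathPrimitive hκ ν (γ.trans γ') 1 = pathPrimitive hκ ν γ 1 + pathPrimitive hκ ν γ' 1 := by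
  simp_rw [pathPrimitive, logLift_trans]
  rw [integral_add (integrable_of_continuous (by fun_prop))
    (integrable_of_continuous (by fun_prop)), mul_add]

theorem isAnalyticContinuationAlong_pathPrimitive (γ : Path a b) {F : ℂ → ℂ}
    (hF : averageLog ν κ a =ᶠ[𝓝 (a : ℂ)] F) :
    IsAnalyticContinuationAlong (γ.map continuous_subtype_val) F
      fun s z => pathPrimitive hκ ν γ s + averageLog ν κ (γ s) z where
  analyticAt t := analyticAt_const.add
    (analyticAt_averageLog fun x h => hκ x (h ▸ (γ t).2))
  start := by
    have h0 : pathPrimitive hκ ν γ 0 = 0 := by simp [pathPrimitive, logLift_zero]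
    simpa [h0] using hF
  compatible t := by
    obtain ⟨δ, hδ, hlow⟩ := exists_pos_le_norm_sub κ (c := γ t) fun x h => hκ x (h ▸ (γ t).2)
    have hγ : Tendsto (fun s => (γ s : ℂ)) (𝓝 t) (𝓝 (γ t)) :=
      (continuous_subtype_val.comp γ.continuous).tendsto t
    filter_upwards [pathPrimitive_eventually_eq hκ ν γ t,
      hγ (Metric.ball_mem_nhds _ (half_pos hδ))] with s hs hst
    filter_upwards [Metric.ball_mem_nhds (γ s : ℂ) (half_pos hδ)] with z hz
    rw [Set.mem_preimage, Metric.mem_ball, dist_eq_norm] at hst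
    rw [Metric.mem_ball, dist_eq_norm] at hz
    rw [hs, ← averageLog_add_averageLog ν hlow hst hz, add_assoc]

end Continuation

/-- Analytic continuation along a path is unique. -/
theorem IsAnalyticContinuationAlong.eventuallyEq {a b : ℂ} {γ : Path a b} {F : ℂ → ℂ}
    {G G' : unitInterval → ℂ → ℂ} (h : IsAnalyticContinuationAlong γ F G)
    (h' : IsAnalyticContinuationAlong γ F G') (t : unitInterval) : G t =ᶠ[𝓝 (γ t)] G' t := by
  -- Agreement of the two germs is locally constant in `t`: the identity theorem carries it between
  -- `γ s` and `γ t` inside a common disc of analyticity. Connectedness of the interval then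
  -- concludes.
  have key (t : unitInterval) : ∀ᶠ s in 𝓝 t,
      (G s =ᶠ[𝓝 (γ s)] G' s ↔ G t =ᶠ[𝓝 (γ t)] G' t) := by
    obtain ⟨r, hr, hG⟩ := Metric.mem_nhds_iff.1 ((h.analyticAt t).eventually_analyticAt)
    obtain ⟨r', hr', hG'⟩ := Metric.mem_nhds_iff.1 ((h'.analyticAt t).eventually_analyticAt)
    set ρ := min r r'
    have hρ : 0 < ρ := lt_min hr hr'
    have hon : AnalyticOnNhd ℂ (G t) (Metric.ball (γ t) ρ) := fun z hz =>
      hG (Metric.ball_subset_ball (min_le_left _ _) hz)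
    have hon' : AnalyticOnNhd ℂ (G' t) (Metric.ball (γ t) ρ) := fun z hz =>
      hG' (Metric.ball_subset_ball (min_le_right _ _) hz)
    have hpre := (convex_ball (γ t) ρ).isPreconnected
    filter_upwards [h.compatible t, h'.compatible t,
      γ.continuous.tendsto t (Metric.ball_mem_nhds _ hρ)] with s hs hs' hsρ
    have spread {c d : ℂ} (hc : c ∈ Metric.ball (γ t) ρ) (hd : d ∈ Metric.ball (γ t) ρ)
        (he : G t =ᶠ[𝓝 c] G' t) : G t =ᶠ[𝓝 d] G' t :=
      (hon.eqOn_of_preconnected_of_eventuallyEq hon' hpre hc he).eventuallyEq_of_mem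
        (Metric.isOpen_ball.mem_nhds hd)
    exact ⟨fun he => spread hsρ (Metric.mem_ball_self hρ) (hs.symm.trans (he.trans hs')),
      fun he => hs.trans ((spread (Metric.mem_ball_self hρ) hsρ he).trans hs'.symm)⟩
  have hclopen : IsClopen {t | G t =ᶠ[𝓝 (γ t)] G' t} := by
    refine ⟨⟨isOpen_iff_mem_nhds.2 fun t ht => ?_⟩, isOpen_iff_mem_nhds.2 fun t ht => ?_⟩
    · filter_upwards [key t] with s hs using fun hs' => ht (hs.1 hs')
    · filter_upwards [key t] with s hs using hs.2 ht
  have huniv := hclopen.eq_univ ⟨0, by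
    simpa using h.start.trans h'.start.symm⟩
  exact huniv.ge (Set.mem_univ t)

theorem isBranchValue_iff_of_isAnalyticContinuationAlong {a b : ℂ} {γ : Path a b} {F : ℂ → ℂ}
    {G : unitInterval → ℂ → ℂ} (h : IsAnalyticContinuationAlong γ F G) (w : ℂ) :
    IsBranchValue γ F w ↔ w = G 1 b := by
  refine ⟨?_, fun hw => ⟨G, h, hw.symm⟩⟩
  rintro ⟨G', h', rfl⟩
  simpa using (h'.eventuallyEq h 1).eq_of_nhds

/-! ### Haar integrals over the `2`-adic integers -/

instance isProbabilityMeasure_haarPadic : IsProbabilityMeasure haarPadic :=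
  ⟨by simpa using! Measure.addHaarMeasure_self (K₀ := (⊤ : TopologicalSpace.PositiveCompacts ℤ_[2]))⟩

instance isAddHaarMeasure_haarPadic : haarPadic.IsAddHaarMeasure := by
  unfold haarPadic; infer_instance

theorem toZModPow_eq_iff_norm_sub_le (k : ℕ) (x y : ℤ_[2]) :
    PadicInt.toZModPow k x = PadicInt.toZModPow k y ↔ ‖x - y‖ ≤ (2 : ℝ) ^ (-(k : ℤ)) := by
  rw [← sub_eq_zero, ← map_sub, ← RingHom.mem_ker, PadicInt.ker_toZModPow,
    ← PadicInt.norm_le_pow_iff_mem_span_pow]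
  norm_num

theorem continuous_comp_toZModPow {X : Type*} [TopologicalSpace X] (k : ℕ) (h : ZMod (2 ^ k) → X) :
    Continuous fun x : ℤ_[2] => h (PadicInt.toZModPow k x) := by
  refine (IsLocallyConstant.iff_eventually_eq _ |>.2 fun x => ?_).continuous
  filter_upwards [Metric.closedBall_mem_nhds x (show 0 < (2 : ℝ) ^ (-(k : ℤ)) by positivity)]
    with y hy
  rw [Metric.mem_closedBall, dist_eq_norm] at hy
  rw [(toZModPow_eq_iff_norm_sub_le k y x).2 hy]

theorem toZModPow_natCast_val (k : ℕ) (j : ZMod (2 ^ k)) :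
    PadicInt.toZModPow k ((j.val : ℕ) : ℤ_[2]) = j := by
  rw [map_natCast, ZMod.natCast_val, ZMod.cast_id]

/-- By translation invariance all `2 ^ k` shifts of the integrand have the same integral, while
their sum is the constant `∑ j, h j`. -/
theorem integral_comp_toZModPow (k : ℕ) (h : ZMod (2 ^ k) → ℂ) :
    ∫ x, h (PadicInt.toZModPow k x) ∂haarPadic = ((2 : ℂ) ^ k)⁻¹ * ∑ j, h j := by
  have hint (j : ZMod (2 ^ k)) :
      Integrable (fun x : ℤ_[2] => h (PadicInt.toZModPow k x + j)) haarPadic :=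
    integrable_of_continuous (continuous_comp_toZModPow k fun i => h (i + j))
  have htrans (j : ZMod (2 ^ k)) : ∫ x, h (PadicInt.toZModPow k x + j) ∂haarPadic =
      ∫ x, h (PadicInt.toZModPow k x) ∂haarPadic := by
    rw [← integral_add_right_eq_self (fun x => h (PadicInt.toZModPow k x))
      (((j.val : ℕ) : ℤ_[2]))]
    simp_rw [map_add, toZModPow_natCast_val]
  have hsum : ∑ j, ∫ x, h (PadicInt.toZModPow k x + j) ∂haarPadic = ∑ j, h j := by
    rw [← integral_finsetSum _ fun j _ => hint j]
    have (x : ℤ_[2]) : ∑ j, h (PadicInt.toZModPow k x + j) = ∑ j, h j :=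
      Equiv.sum_comp (Equiv.addLeft (PadicInt.toZModPow k x)) h
    simp [this]
  simp_rw [htrans, Finset.sum_const, Finset.card_univ, ZMod.card, nsmul_eq_mul] at hsum
  rw [← hsum]
  push_cast
  field_simp

/-- Uniform continuity on the compact `ℤ_[2]`: points congruent modulo a high power of `2` have
values at distance less than `1`, hence equal. -/
theorem exists_eq_comp_toZModPow {g : ℤ_[2] → ℤ} (hg : Continuous g) :
    ∃ (k : ℕ) (h : ZMod (2 ^ k) → ℤ), ∀ x, g x = h (PadicInt.toZModPow k x) := by
  obtain ⟨δ, hδ, H⟩ := Metric.uniformContinuous_iff.1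
    (CompactSpace.uniformContinuous_of_continuous hg) 1 one_pos
  obtain ⟨k, hk⟩ := exists_pow_lt_of_lt_one hδ (show (1 / 2 : ℝ) < 1 by norm_num)
  refine ⟨k, fun j => g (j.val : ℕ), fun x => ?_⟩
  have hle := (toZModPow_eq_iff_norm_sub_le k x _).1 (toZModPow_natCast_val k
    (PadicInt.toZModPow k x)).symm
  rw [zpow_neg, zpow_natCast, ← inv_pow, inv_eq_one_div, ← dist_eq_norm] at hle
  have := H (hle.trans_lt hk)
  rw [Int.dist_eq] at this
  exact sub_eq_zero.1 (Int.abs_lt_one_iff.1 (by exact_mod_cast this))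

theorem integral_intCast_mem_dyadicRationals {g : ℤ_[2] → ℤ} (hg : Continuous g) :
    ∫ x, (g x : ℂ) ∂haarPadic ∈ dyadicRationals := by
  obtain ⟨k, h, hh⟩ := exists_eq_comp_toZModPow hg
  simp_rw [hh]
  rw [integral_comp_toZModPow k fun j => (h j : ℂ)]
  refine AddSubgroup.mem_iSup_of_mem k (AddSubgroup.mem_zmultiples_iff.2 ⟨∑ j, h j, ?_⟩)
  rw [zsmul_eq_mul, mul_comm]
  push_cast
  rfl

/-! ### Binary digits and the pieces of the Cantor set -/

theorem toZModPow_eq_zero_iff (k : ℕ) (x : ℤ_[2]) :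
    PadicInt.toZModPow k x = 0 ↔ ∀ n < k, binaryDigit x n = false := by
  have hcast (n : ℕ) (h : PadicInt.toZModPow (n + 1) x = 0) : PadicInt.toZModPow n x = 0 := by
    rw [← PadicInt.cast_toZModPow n (n + 1) n.le_succ, h]
    simp
  induction k with
  | zero => simpa using Subsingleton.elim (α := ZMod 1) _ _
  | succ k ih =>
    rw [Nat.forall_lt_succ_right]
    refine ⟨fun h => ⟨ih.1 (hcast k h), by simp [binaryDigit, h]⟩, fun ⟨h0, hb⟩ => ?_⟩
    replace h0 := ih.2 h0
    rw [binaryDigit] at hb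
    rw [← PadicInt.cast_toZModPow k (k + 1) k.le_succ] at h0
    set v := PadicInt.toZModPow (k + 1) x
    -- The representative of `v` is `2 ^ k * q` with `q < 2`, and its digit of index `k` is the
    -- parity of `q`.
    rw [← ZMod.natCast_val, ZMod.natCast_eq_zero_iff] at h0
    obtain ⟨q, hq⟩ := h0
    have hlt := ZMod.val_lt v
    have hq2 : q < 2 := by
      rw [hq, pow_succ] at hlt
      exact lt_of_mul_lt_mul_left hlt (Nat.zero_le _)
    rw [hq, Nat.testBit_eq_decide_div_mod_eq, Nat.mul_div_cancel_left _ (by positivity)] at hb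
    have : q = 0 := by
      simp only [decide_eq_false_iff_not] at hb
      omega
    rw [← ZMod.val_eq_zero, hq, this, mul_zero]

/-- The bound lies in the gap between `3⁻ᵏ` and `2 * 3⁻ᵏ`: a nonzero digit of index below `k`
contributes at least `2 * 3⁻ᵏ`, and the remaining digits together at most `3⁻ᵏ`. -/
theorem toCantor_lt_iff (k : ℕ) (x : ℤ_[2]) :
    toCantor x < 3 / 2 * (1 / 3) ^ k ↔ PadicInt.toZModPow k x = 0 := by
  have hpos : (0 : ℝ) < (1 / 3) ^ k := by positivity
  rw [toZModPow_eq_zero_iff]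
  constructor
  · intro hlt n hn
    by_contra hb
    rw [Bool.not_eq_false] at hb
    have h1 := Real.summable_ofDigitsTerm.le_tsum (f := Real.ofDigitsTerm (b := 3)
      fun n => cond (binaryDigit x n) 2 0) n fun _ _ => Real.ofDigitsTerm_nonneg
    have h2 : Real.ofDigitsTerm (b := 3) (fun n => cond (binaryDigit x n) 2 0) n
        = 2 * (1 / 3) ^ (n + 1) := by
      simp [Real.ofDigitsTerm, hb]
    have h3 : ((1 : ℝ) / 3) ^ k ≤ (1 / 3) ^ (n + 1) :=
      pow_le_pow_of_le_one (by norm_num) (by norm_num) hn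
    rw [h2] at h1
    have h4 : 2 * (1 / 3) ^ (n + 1) ≤ toCantor x := h1
    linarith
  · intro h
    have h0 : Real.ofDigits (b := 3) (fun _ => 0) = 0 := by
      simp [Real.ofDigits, Real.ofDigitsTerm]
    have := Real.abs_ofDigits_sub_ofDigits_le (b := 3)
      (x := fun n => cond (binaryDigit x n) 2 0) (y := fun _ => 0) (n := k)
      fun i hi => by simp [h i hi]
    rw [h0, sub_zero] at this
    have h5 : toCantor x ≤ (1 / 3) ^ k := by
      refine (le_abs_self _).trans (this.trans (by simp))
    linarith

/-- These are centres of removed gaps. Being at most `1 / 2`, such a point could only lie in the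
left third, and tripling it descends to the case `1 / 2`. -/
theorem three_halves_mul_notMem_cantorSet (k : ℕ) : (3 / 2 * (1 / 3) ^ (k + 1) : ℝ) ∉ cantorSet := by
  have hle : (3 / 2 * (1 / 3) ^ (k + 1) : ℝ) ≤ 1 / 2 := by
    have : ((1 : ℝ) / 3) ^ k ≤ 1 := pow_le_one₀ (by norm_num) (by norm_num)
    rw [pow_succ]
    linarith
  induction k with
  | zero =>
    intro h
    exact zero_notMem_centredCantorSet ⟨_, h, by norm_num [centre]⟩
  | succ k ih =>
    intro h
    rw [cantorSet_eq_union_halves] at h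
    rcases h with ⟨y, hy, h⟩ | ⟨y, hy, h⟩
    · have hy' : y = 3 / 2 * (1 / 3) ^ (k + 1) := by
        simp only at h
        rw [pow_succ] at h
        linarith
      refine ih ?_ (hy' ▸ hy)
      have : ((1 : ℝ) / 3) ^ k ≤ 1 := pow_le_one₀ (by norm_num) (by norm_num)
      rw [pow_succ]
      linarith
    · have := (cantorSet_subset_unitInterval hy).1
      simp only at h
      linarith

theorem toCantor_mem_cantorSet (x : ℤ_[2]) : toCantor x ∈ cantorSet :=
  ofDigits_bool_to_fin_three_mem_cantorSet _

/-! ### Loops around pieces of the Cantor set -/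

/-- The parametrization of the centred Cantor set by the `2`-adic integers. -/
def cantorParam : C(ℤ_[2], ℂ) where
  toFun x := centre (toCantor x)
  continuous_toFun := by
    have := continuous_toCantor
    unfold centre
    fun_prop

theorem cantorParam_notMem (x : ℤ_[2]) : cantorParam x ∉ centredCantorSetᶜ :=
  fun h => h ⟨_, toCantor_mem_cantorSet x, rfl⟩

/-- The loop based at the origin that runs once around the circle of diameter `[-2 * r, 0]`. -/
def circleLoop (r : ℝ) (hr : ((-2 * r : ℝ) : ℂ) ∉ centredCantorSet) : Path origin origin where
  toFun s := ⟨r * (exp (2 * Real.pi * s * I) - 1), fun ⟨x, hx, h⟩ => by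
    -- `K` is real, and the circle meets the real line only at `0` and `-2 * r`.
    have hsq : (x - 1 / 2) * (x - 1 / 2 + 2 * r) = 0 := by
      have h1 : ‖((x - 1 / 2 + r : ℝ) : ℂ)‖ = ‖(r : ℂ)‖ := by
        have : ((x - 1 / 2 + r : ℝ) : ℂ) = r * exp ((2 * Real.pi * s : ℝ) * I) := by
          rw [ofReal_add]
          push_cast
          have h' : ((x : ℂ) - 1 / 2) = r * (exp (2 * Real.pi * s * I) - 1) := by
            simpa [centre] using h
          rw [h']
          ring
        rw [this, norm_mul, norm_exp_ofReal_mul_I, mul_one]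
      rw [norm_real, norm_real, Real.norm_eq_abs, Real.norm_eq_abs, ← sq_eq_sq_iff_abs_eq_abs] at h1
      linear_combination h1
    rcases mul_eq_zero.1 hsq with h0 | h0
    · exact zero_notMem_centredCantorSet ⟨x, hx, by rw [centre, h0, ofReal_zero]⟩
    · exact hr ⟨x, hx, by rw [centre]; congr 1; linarith⟩⟩
  continuous_toFun := by fun_prop
  source' := Subtype.ext (by simp [origin])
  target' := Subtype.ext (by simp [origin, exp_two_pi_mul_I])

theorem circleLoop_apply (r : ℝ) (hr : ((-2 * r : ℝ) : ℂ) ∉ centredCantorSet) (s : unitInterval) :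
    (circleLoop r hr s : ℂ) = r * (exp (2 * Real.pi * s * I) - 1) := rfl

section LogAlongCircle

variable {r : ℝ} (hr : ((-2 * r : ℝ) : ℂ) ∉ centredCantorSet) {x : ℤ_[2]} {y : ℝ}
  (hy : cantorParam x = y)
include hy

theorem logLift_circleLoop_of_mem (h1 : -2 * r < y) (h2 : y < 0) :
    logLift cantorParam_notMem (circleLoop r hr) (1, x) = 2 * Real.pi * I := by
  have hy0 : (y : ℂ) ≠ 0 := ofReal_ne_zero.2 h2.ne
  -- Pulling `exp (2πis)` out of the ratio leaves `u`, which has positive real part because `|r + y|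
  -- < r`. The lift is thus `2πis` plus a principal logarithm that closes up.
  let u : unitInterval → ℂ := fun s => (r - (r + y) * exp ((-(2 * Real.pi * s) : ℝ) * I)) / (-y)
  have hu : ∀ s, 0 < (u s).re := fun s => by
    have : (u s).re = (r - (r + y) * Real.cos (-(2 * Real.pi * s))) / (-y) := by
      simp only [u]
      rw [← ofReal_neg, div_ofReal_re, sub_re, ← ofReal_add, re_ofReal_mul, exp_ofReal_mul_I_re,
        ofReal_re]
    rw [this]
    refine div_pos ?_ (by linarith)
    have hc := Real.cos_le_one (-(2 * Real.pi * s))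
    have hc' := Real.neg_one_le_cos (-(2 * Real.pi * s))
    rcases le_total 0 (r + y) with h | h <;> nlinarith
  have hu0 : ∀ s, u s ≠ 0 := fun s h => by simpa [h] using hu s
  let Γ : unitInterval → ℂ := fun s => 2 * Real.pi * s * I + log (u s)
  have hΓ : Continuous Γ := by
    have hcu : Continuous u := by fun_prop
    exact Continuous.add (by fun_prop) (hcu.clog fun s => Or.inl (hu s))
  have hu01 (s : unitInterval) (hs : exp ((-(2 * Real.pi * s) : ℝ) * I) = 1) : u s = 1 := by
    simp only [u]
    rw [hs]
    field_simp
    ring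
  rw [logLift_eq _ _ _ hΓ]
  · simp only [Γ]
    rw [hu01 1]
    · simp
    · rw [exp_eq_one_iff]
      exact ⟨-1, by simp⟩
  · simp only [Γ]
    rw [hu01 0 (by simp)]
    simp
  · intro s
    simp only [Γ]
    rw [exp_add, exp_log (hu0 s), hy, circleLoop_apply, origin]
    have he : exp (2 * Real.pi * s * I) * exp ((-(2 * Real.pi * s) : ℝ) * I) = 1 := by
      rw [← exp_add]
      simp
    simp only [u, zero_sub]
    rw [mul_div_assoc']
    congr 1
    linear_combination (-(r + y) : ℂ) * he

theorem logLift_circleLoop_of_notMem (hr0 : 0 < r) (h : y < -2 * r ∨ 0 < y) :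
    logLift cantorParam_notMem (circleLoop r hr) (1, x) = 0 := by
  have hy0' : y ≠ 0 := by rcases h with h | h <;> intro h' <;> linarith
  have hy0 : (y : ℂ) ≠ 0 := ofReal_ne_zero.2 hy0'
  -- With `y` outside the circle, the ratio itself stays in the right half-plane, so its principal
  -- logarithm is the lift and returns to `0`.
  let u : unitInterval → ℂ := fun s => (r * (exp ((2 * Real.pi * s : ℝ) * I) - 1) - y) / (-y)
  have hu : ∀ s, 0 < (u s).re := fun s => by
    have : (u s).re = (r * (Real.cos (2 * Real.pi * s) - 1) - y) / (-y) := by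
      simp only [u]
      rw [← ofReal_neg, div_ofReal_re, sub_re, re_ofReal_mul, sub_re, exp_ofReal_mul_I_re,
        ofReal_re, one_re]
    rw [this]
    have hc := Real.cos_le_one (2 * Real.pi * s)
    have hc' := Real.neg_one_le_cos (2 * Real.pi * s)
    rcases h with h | h
    · exact div_pos (by nlinarith) (by linarith)
    · exact div_pos_of_neg_of_neg (by nlinarith) (by linarith)
  have hu0 : ∀ s, u s ≠ 0 := fun s h => by simpa [h] using hu s
  have hu01 (s : unitInterval) (hs : exp ((2 * Real.pi * s : ℝ) * I) = 1) : u s = 1 := by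
    simp only [u]
    rw [hs]
    field_simp
    ring
  have hcu : Continuous u := by fun_prop
  rw [logLift_eq (Γ := fun s => log (u s)) _ _ _ (hcu.clog fun s => Or.inl (hu s))]
  · rw [hu01 1 (by simp [exp_two_pi_mul_I]), log_one]
  · rw [hu01 0 (by simp), log_one]
  · intro s
    rw [exp_log (hu0 s), hy, circleLoop_apply, origin]
    simp [u]

end LogAlongCircle

theorem cantorParam_eq (x : ℤ_[2]) : cantorParam x = ((toCantor x - 1 / 2 : ℝ) : ℂ) := rfl

theorem logLift_circleLoop {r : ℝ} (hr : ((-2 * r : ℝ) : ℂ) ∉ centredCantorSet) (hr0 : 0 < r)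
    (x : ℤ_[2]) : logLift cantorParam_notMem (circleLoop r hr) (1, x) =
      if -2 * r < toCantor x - 1 / 2 ∧ toCantor x - 1 / 2 < 0 then 2 * (Real.pi : ℂ) * I else 0 := by
  split_ifs with h
  · exact logLift_circleLoop_of_mem hr (cantorParam_eq x) h.1 h.2
  · refine logLift_circleLoop_of_notMem hr (cantorParam_eq x) hr0 ?_
    have h1 : toCantor x - 1 / 2 ≠ -2 * r := fun h' =>
      hr ⟨_, toCantor_mem_cantorSet x, by rw [centre, h']⟩
    have h2 : toCantor x - 1 / 2 ≠ 0 := fun h' =>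
      zero_notMem_centredCantorSet ⟨_, toCantor_mem_cantorSet x, by rw [centre, h', ofReal_zero]⟩
    rcases h1.lt_or_gt with h1 | h1
    · exact Or.inl h1
    · exact Or.inr (h2.lt_or_gt.resolve_left fun h2 => h ⟨h1, h2⟩)

/-! ### The monodromy homomorphism -/

theorem exists_pathPrimitive_sub_eq (k : ℕ) :
    ∃ γ γ' : Path origin origin,
      pathPrimitive cantorParam_notMem haarPadic γ 1 -
        pathPrimitive cantorParam_notMem haarPadic γ' 1 = ((2 : ℂ) ^ (k + 2))⁻¹ := by
  -- The centre of the gap just right of the leftmost piece of level `k + 2`. The shift by `2` keeps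
  -- `d` below `1 / 2`, so the smaller circle is nondegenerate.
  set d : ℝ := 3 / 2 * (1 / 3) ^ (k + 2) with hd
  have hd6 : d ≤ 1 / 6 := by
    have : ((1 : ℝ) / 3) ^ k ≤ 1 := pow_le_one₀ (by norm_num) (by norm_num)
    rw [hd, pow_add]
    linarith
  have hd0 : 0 < d := by positivity
  have hdC : d ∉ cantorSet := three_halves_mul_notMem_cantorSet (k + 1)
  have h1 : ((-2 * 1 : ℝ) : ℂ) ∉ centredCantorSet := by
    rintro ⟨x, hx, h⟩
    have h2 : x - 1 / 2 = -2 * 1 := ofReal_injective h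
    have := (cantorSet_subset_unitInterval hx).1
    linarith
  have h2 : ((-2 * ((1 / 2 - d) / 2) : ℝ) : ℂ) ∉ centredCantorSet := by
    rintro ⟨x, hx, h⟩
    have h2 : x - 1 / 2 = -2 * ((1 / 2 - d) / 2) := ofReal_injective h
    have h3 : x = d := by linarith
    exact hdC (h3 ▸ hx)
  refine ⟨circleLoop _ h1, circleLoop _ h2, ?_⟩
  rw [pathPrimitive, pathPrimitive, ← mul_sub, ← integral_sub
    (integrable_of_continuous (by fun_prop)) (integrable_of_continuous (by fun_prop))]
  have hval (x : ℤ_[2]) :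
      logLift cantorParam_notMem (circleLoop _ h1) (1, x) -
        logLift cantorParam_notMem (circleLoop _ h2) (1, x) =
      (2 * (Real.pi : ℂ) * I) * (if PadicInt.toZModPow (k + 2) x = 0 then 1 else 0) := by
    rw [logLift_circleLoop h1 one_pos, logLift_circleLoop h2 (by linarith)]
    have hnn := (cantorSet_subset_unitInterval (toCantor_mem_cantorSet x)).1
    have hiff := toCantor_lt_iff (k + 2) x
    rw [← hd] at hiff
    have hne : toCantor x ≠ d := fun h => hdC (h ▸ toCantor_mem_cantorSet x)
    simp only [← hiff]
    by_cases hlt : toCantor x < d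
    · rw [if_pos ⟨by linarith, by linarith⟩, if_neg fun h => by linarith [h.1], if_pos hlt]
      ring
    · have hgt := lt_of_le_of_ne (not_lt.1 hlt) hne.symm
      rw [if_neg hlt]
      by_cases hhalf : toCantor x - 1 / 2 < 0
      · rw [if_pos ⟨by linarith, hhalf⟩, if_pos ⟨by linarith, hhalf⟩]
        ring
      · rw [if_neg fun h => hhalf h.2, if_neg fun h => hhalf h.2]
        ring
  simp_rw [hval]
  rw [integral_const_mul, inv_mul_cancel_left₀ two_pi_I_ne_zero,
    integral_comp_toZModPow (k + 2) fun j => if j = 0 then 1 else 0]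
  simp

theorem pathPrimitive_mem_dyadicRationals (γ : Path origin origin) :
    pathPrimitive cantorParam_notMem haarPadic γ 1 ∈ dyadicRationals := by
  choose n hn using exists_logLift_one_eq cantorParam_notMem γ
  have hn' (x : ℤ_[2]) : ((n x : ℤ) : ℂ) =
      logLift cantorParam_notMem γ (1, x) / (2 * Real.pi * I) := by
    rw [hn, mul_div_cancel_right₀ _ two_pi_I_ne_zero]
  have hcont : Continuous n := by
    rw [Int.isClosedEmbedding_coe_real.isEmbedding.continuous_iff]
    have : ((↑) : ℤ → ℝ) ∘ n =
        fun x => (logLift cantorParam_notMem γ (1, x) / (2 * Real.pi * I)).re := by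
      funext x
      rw [← hn', Function.comp_apply, intCast_re]
    rw [this]
    fun_prop
  have := integral_intCast_mem_dyadicRationals hcont
  simp_rw [hn'] at this
  rwa [integral_div, div_eq_inv_mul] at this

/-- The monodromy homomorphism, as the integral over the Cantor set of the winding numbers. -/
def monodromyHom : Additive (FundamentalGroup (centredCantorSetᶜ : Set ℂ) origin) →+ ℂ :=
  AddMonoidHom.mk' (fun g => Quotient.lift
      (fun γ : Path origin origin => pathPrimitive cantorParam_notMem haarPadic γ 1)
      (fun γ γ' h => by
        simp_rw [pathPrimitive, logLift_one_eq_of_homotopic cantorParam_notMem h])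
      g.toMul) fun g g' => by
    induction g using Quotient.inductionOn with | _ γ
    induction g' using Quotient.inductionOn with | _ γ'
    -- The product of the group unfolds to concatenation in the opposite order, which is harmless in
    -- the commutative target.
    exact (pathPrimitive_trans cantorParam_notMem haarPadic γ' γ).trans (add_comm _ _)

theorem monodromyHom_mk (γ : Path origin origin) :
    monodromyHom (Additive.ofMul (FundamentalGroup.fromPath (Path.Homotopic.Quotient.mk γ))) =
      pathPrimitive cantorParam_notMem haarPadic γ 1 := rfl

theorem cauchyTransform_cantorMeasure (z : ℂ) : cauchyTransform cantorMeasure z =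
    (2 * (Real.pi : ℂ) * I)⁻¹ * ∫ x, (z - cantorParam x)⁻¹ ∂haarPadic := by
  rw [cauchyTransform, cantorMeasure, integral_map]
  · rfl
  · exact cantorParam.continuous.aemeasurable
  · exact (measurable_const.sub measurable_id).inv.aestronglyMeasurable

theorem range_monodromyHom : monodromyHom.range = dyadicRationals := by
  apply le_antisymm
  · rintro _ ⟨g, rfl⟩
    induction g using Quotient.inductionOn with | _ γ
    exact pathPrimitive_mem_dyadicRationals γ
  · refine iSup_le fun k => AddSubgroup.zmultiples_le_of_mem ?_
    obtain ⟨γ, γ', h⟩ := exists_pathPrimitive_sub_eq k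
    rw [← monodromyHom_mk, ← monodromyHom_mk] at h
    have hmem : ((2 : ℂ) ^ (k + 2))⁻¹ ∈ monodromyHom.range :=
      h ▸ sub_mem ⟨_, rfl⟩ ⟨_, rfl⟩
    have : ((2 : ℂ) ^ k)⁻¹ = (4 : ℕ) • ((2 : ℂ) ^ (k + 2))⁻¹ := by
      rw [nsmul_eq_mul, pow_add]
      push_cast
      field_simp
      norm_num
    rw [this]
    exact nsmul_mem hmem 4

end CantorMonodromy

end

theorem mainTheorem2 :
    ∃ Mon : Additive (FundamentalGroup (CantorMonodromy.centredCantorSetᶜ : Set ℂ)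
        CantorMonodromy.origin) →+ ℂ,
      (∀ (γ : Path CantorMonodromy.origin CantorMonodromy.origin) (w : ℂ),
        CantorMonodromy.IsBranchValue (γ.map continuous_subtype_val)
            (CantorMonodromy.primitiveAtZero
              (CantorMonodromy.cauchyTransform CantorMonodromy.cantorMeasure)) w ↔
          w = Mon (Additive.ofMul (FundamentalGroup.fromPath (Path.Homotopic.Quotient.mk γ)))) ∧
      Mon.range = CantorMonodromy.dyadicRationals := by
  open CantorMonodromy in
  refine ⟨monodromyHom, fun γ w => ?_, range_monodromyHom⟩
  have h0 (x : ℤ_[2]) : (0 : ℂ) ≠ cantorParam x := fun h =>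
    cantorParam_notMem x (h ▸ zero_notMem_centredCantorSet)
  have hF := primitiveAtZero_eventuallyEq (ν := haarPadic) h0
  simp_rw [← cauchyTransform_cantorMeasure] at hF
  rw [isBranchValue_iff_of_isAnalyticContinuationAlong
    (isAnalyticContinuationAlong_pathPrimitive cantorParam_notMem haarPadic γ hF),
    monodromyHom_mk, γ.target]
  have : averageLog haarPadic cantorParam origin origin = 0 := averageLog_self h0
  rw [this, add_zero]
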